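/- All meet-semilattices have a top element. A meet-semilattice $M$ is distributive if $a\wedge b\le c$ implies that there are $a'\ge a$, $b'\ge b$ with $a'\wedge b'=c$. An element $k$ of a complete lattice $L$ is compact if $k\le\bigvee S$ implies $k\le\bigvee T$ for some finite $T\subseteq S$; a frame is algebraic if each of its elements is a join of compact elements, and an algebraic frame is arithmetic if $a\wedge b$ is compact whenever $a,b$ are compact. Arithmetic frames. $\mathsf{ArFrm}_{\mathsf J}$ is the category of arithmetic frames and maps preserving arbitrary joins and compact elements. $\mathsf{ArFrm}_{\mathsf S}$ is its wide subcategory of those $\alpha$ such that $\alpha(\bigwedge S)=\bigwedge\alpha[S]$ for each nonempty finite set $S$ of compact elements whose meet is compact. $\mathsf{ArFrm}$ is the wide subcategory of those $\alpha$ that preserve all finite meets, including the top. Lattices. $\mathsf{DL}^-_{\mathsf M}$ is the category of distributive meet-semilattices that are lattices (that is, distributive lattices with top but possibly without bottom) and maps preserving all finite meets, including the top. $\mathsf{DL}^-$ is its wide subcategory of maps that preserve existing joins of nonempty finite sets (that is, of lattice homomorphisms preserving the top). $\mathsf{DL}^-_{\mathsf P}$ is the wide subcategory of those $\alpha:M_1\to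 M_2$ such that, for each finite (possibly empty) $S\subseteq M_1$ and each upper bound $x$ of $\alpha[S]$, there is an upper bound $c$ of $S$ with $\alpha(c)\le x$. Spaces. A Priestley space is a compact ordered space in which $x\not\le y$ implies that some clopen upset contains $x$ and misses $y$. Given a subset $X_0$ of a Priestley space $X$, a clopen upset $U$ is admissible if $\max(X\setminus U)\subseteq X_0$; let $\mathcal A(X)$ be the set of admissible clopen upsets and $\mathcal I_x=\{U\in\mathcal A(X): x\notin U\}$. A pointed generalized Priestley space is a tuple $(X,\tau,\le,X_0,m)$ where $(X,\tau,\le)$ is a Priestley space, $m$ is the greatest element of $X$, $X_0$ is a dense subset of $X\setminus\{m\}$, each $x\ne m$ lies below some element of $X_0$, $x\in X_0$ iff $\mathcal I_x$ is nonempty and directed, and $x\le y$ iff every $U\in\mathcal A(X)$ containing $x$ contains $y$. It is a pointed Priestley space if $X_0=X\setminus\{m\}$. For a relation $R\subseteq X\times Y$ put $\Box_RU=\{x\in X: R[x]\subseteq U\}$. A generalized Priestley morphism is a relation $R\subseteq X\times Y$ such that $\Box_RU\in\mathcal A(X)$ for all $U\in\mathcal A(Y)$, and, whenever $(x,y)\notin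 R$, there is $U\in\mathcal A(Y)$ with $R[x]\subseteq U$ and $y\notin U$. $\mathsf{PPS}$ is the category of pointed Priestley spaces and generalized Priestley morphisms; the identities are the orders $\le$, and the composite of $R\subseteq X\times Y$ and $T\subseteq Y\times Z$ is given by $x\,(T*R)\,z$ iff every $U\in\mathcal A(Z)$ with $x\in\Box_R\Box_TU$ contains $z$. $\mathsf{PPS}_{\mathsf S}$ is the category of pointed Priestley spaces and strong Priestley morphisms, i.e. order-preserving maps $f:X\to Y$ with $f^{-1}(U)\in\mathcal A(X)$ for all $U\in\mathcal A(Y)$. $\mathsf{PPS}_{\mathsf P}$ is its wide subcategory of the maps with $f[X_0]\subseteq Y_0$. Theorem. 1. $\mathsf{ArFrm}_{\mathsf J}$ is equivalent to $\mathsf{DL}^-_{\mathsf M}$ and dually equivalent to $\mathsf{PPS}$. 2. $\mathsf{ArFrm}_{\mathsf S}$ is equivalent to $\mathsf{DL}^-$ and dually equivalent to $\mathsf{PPS}_{\mathsf S}$. 3. $\mathsf{ArFrm}$ is equivalent to $\mathsf{DL}^-_{\mathsf P}$ and dually equivalent to $\mathsf{PPS}_{\mathsf P}$. -/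

import Mathlib

open CategoryTheory

universe u

namespace PointedPriestley

/-! ### Algebraic frames -/

/-- An algebraic frame: a frame in which every element is a join of compact elements. -/
structure AlgFrmJ : Type (u + 1) where
  carrier : Type u
  [frame : Order.Frame carrier]
  [algebraic : IsCompactlyGenerated carrier]

attribute [instance] AlgFrmJ.frame AlgFrmJ.algebraic

namespace AlgFrmJ

instance : CoeSort AlgFrmJ.{u} (Type u) := ⟨AlgFrmJ.carrier⟩

/-- Maps preserving arbitrary joins and compact elements (finite meets need not be preserved). -/
@[ext]
structure Hom (L M : AlgFrmJ.{u}) where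
  map : sSupHom L M
  map_compact : ∀ k : L, IsCompactElement k → IsCompactElement (map k)

instance : Category AlgFrmJ.{u} where
  Hom L M := Hom L M
  id L := ⟨sSupHom.id L, fun _ hk => hk⟩
  comp f g := ⟨g.map.comp f.map, fun k hk => g.map_compact _ (f.map_compact k hk)⟩

/-- Meets of nonempty finite sets of compact elements are preserved whenever they are compact. -/
def PreservesCompactMeets : MorphismProperty AlgFrmJ.{u} := fun L _ f =>
  ∀ S : Set L, S.Finite → S.Nonempty → (∀ s ∈ S, IsCompactElement s) → IsCompactElement (sInf S) →
    f.map (sInf S) = sInf (f.map '' S)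

instance : PreservesCompactMeets.{u}.IsMultiplicative where
  id_mem L := by
    intro S _ _ _ _
    change sInf S = sInf ((fun x => x) '' S)
    rw [Set.image_id']
  comp_mem f g hf hg := by
    intro S hS hne hc hk
    change g.map (f.map (sInf S)) = sInf ((fun x => g.map (f.map x)) '' S)
    have h := hf S hS hne hc hk
    rw [h, hg (f.map '' S) (hS.image _) (hne.image _)
      (by rintro _ ⟨s, hs, rfl⟩; exact f.map_compact s (hc s hs))
      (h ▸ f.map_compact _ hk), Set.image_image]

/-- All finite meets, the empty one included, are preserved. -/
def PreservesFiniteMeets : MorphismProperty AlgFrmJ.{u} := fun L _ f =>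
  ∀ S : Set L, S.Finite → f.map (sInf S) = sInf (f.map '' S)

instance : PreservesFiniteMeets.{u}.IsMultiplicative where
  id_mem L := by
    intro S _
    change sInf S = sInf ((fun x => x) '' S)
    rw [Set.image_id']
  comp_mem f g hf hg := by
    intro S hS
    change g.map (f.map (sInf S)) = sInf ((fun x => g.map (f.map x)) '' S)
    rw [hf S hS, hg (f.map '' S) (hS.image _), Set.image_image]

/-- An algebraic frame is arithmetic if binary meets of compact elements are compact. -/
def IsArithmetic : ObjectProperty AlgFrmJ.{u} := fun L =>
  ∀ a b : L, IsCompactElement a → IsCompactElement b → IsCompactElement (a ⊓ b)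

end AlgFrmJ

/-- Algebraic frames with the morphisms that preserve compact meets of nonempty finite sets of
compact elements. -/
abbrev AlgFrmS := WideSubcategory AlgFrmJ.PreservesCompactMeets.{u}

/-- Algebraic frames with the frame homomorphisms that preserve compact elements. -/
abbrev AlgFrm := WideSubcategory AlgFrmJ.PreservesFiniteMeets.{u}

abbrev ArFrmJ := AlgFrmJ.IsArithmetic.{u}.FullSubcategory

abbrev ArFrmS :=
  ObjectProperty.FullSubcategory (C := AlgFrmS.{u}) fun L => AlgFrmJ.IsArithmetic L.obj

abbrev ArFrm :=
  ObjectProperty.FullSubcategory (C := AlgFrm.{u}) fun L => AlgFrmJ.IsArithmetic L.obj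

/-! ### Distributive meet-semilattices -/

/-- Distributivity of a meet-semilattice. -/
def IsDistributive : ObjectProperty SemilatInfCat.{u} := fun M =>
  ∀ a b c : M, a ⊓ b ≤ c → ∃ a' b' : M, a ≤ a' ∧ b ≤ b' ∧ a' ⊓ b' = c

/-- Distributive meet-semilattices (with top) and maps preserving all finite meets (hence top). -/
abbrev DMS := IsDistributive.{u}.FullSubcategory

namespace DMS

/-- The underlying map of a morphism. -/
def map {M N : DMS.{u}} (f : M ⟶ N) : InfTopHom M.obj N.obj := f.hom

/-- Joins of nonempty finite sets are preserved whenever they exist. -/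
def PreservesJoins : MorphismProperty DMS.{u} := fun M _ f =>
  ∀ (S : Set M.obj) (a : M.obj), S.Finite → S.Nonempty → IsLUB S a → IsLUB (map f '' S) (map f a)

instance : PreservesJoins.{u}.IsMultiplicative where
  id_mem M := by
    intro S a _ _ h
    change IsLUB ((fun x => x) '' S) a
    rwa [Set.image_id']
  comp_mem f g hf hg := by
    intro S a hS hne h
    change IsLUB ((fun x => map g (map f x)) '' S) (map g (map f a))
    rw [← Set.image_image (map g) (map f)]
    exact hg _ _ (hS.image _) (hne.image _) (hf S a hS hne h)

/-- Every upper bound of the image of a finite set `S` (possibly empty) lies above the image of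
an upper bound of `S`. -/
def LiftsUpperBounds : MorphismProperty DMS.{u} := fun M N f =>
  ∀ (S : Set M.obj) (x : N.obj), S.Finite → x ∈ upperBounds (map f '' S) →
    ∃ c ∈ upperBounds S, map f c ≤ x

instance : LiftsUpperBounds.{u}.IsMultiplicative where
  id_mem M := by
    intro S x _ h
    change x ∈ upperBounds ((fun x => x) '' S) at h
    rw [Set.image_id'] at h
    exact ⟨x, h, le_rfl⟩
  comp_mem f g hf hg := by
    intro S x hS h
    change x ∈ upperBounds ((fun x => map g (map f x)) '' S) at h
    rw [← Set.image_image (map g) (map f)] at h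
    obtain ⟨c, hc, hcx⟩ := hg _ x (hS.image _) h
    obtain ⟨d, hd, hdc⟩ := hf S c hS hc
    exact ⟨d, hd, le_trans (OrderHomClass.mono (map g) hdc) hcx⟩

/-- A meet-semilattice is a lattice if all binary joins exist (a bottom is not required). -/
def IsLattice : ObjectProperty DMS.{u} := fun M =>
  ∀ a b : M.obj, ∃ c : M.obj, IsLUB {a, b} c

end DMS

abbrev DMSS := WideSubcategory DMS.PreservesJoins.{u}

abbrev DMSP := WideSubcategory DMS.LiftsUpperBounds.{u}

/-- Distributive lattices with top and maps preserving all finite meets. -/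
abbrev DLM := DMS.IsLattice.{u}.FullSubcategory

/-- Distributive lattices with top and lattice homomorphisms preserving top. -/
abbrev DL :=
  ObjectProperty.FullSubcategory (C := DMSS.{u}) fun M => DMS.IsLattice M.obj

/-- Distributive lattices with top, morphisms lifting upper bounds of finite sets. -/
abbrev DLP :=
  ObjectProperty.FullSubcategory (C := DMSP.{u}) fun M => DMS.IsLattice M.obj

/-! ### Pointed generalized Priestley spaces -/

/-- Admissible clopen upsets with respect to `X₀`: the maximal points of the complement
belong to `X₀`. -/
def IsAdmissible {α : Type u} [PartialOrder α] [TopologicalSpace α] (X₀ U : Set α) : Prop :=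
  IsClopen U ∧ IsUpperSet U ∧ ∀ x, Maximal (fun y => y ∉ U) x → x ∈ X₀

theorem IsAdmissible.univ {α : Type u} [PartialOrder α] [TopologicalSpace α] (X₀ : Set α) :
    IsAdmissible X₀ Set.univ :=
  ⟨isClopen_univ, isUpperSet_univ, fun _ hx => absurd (Set.mem_univ _) hx.prop⟩

theorem IsAdmissible.inter {α : Type u} [PartialOrder α] [TopologicalSpace α] {X₀ U V : Set α}
    (hU : IsAdmissible X₀ U) (hV : IsAdmissible X₀ V) : IsAdmissible X₀ (U ∩ V) := by
  refine ⟨hU.1.inter hV.1, hU.2.1.inter hV.2.1, fun x hx => ?_⟩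
  by_cases h : x ∈ U
  · exact hV.2.2 x ⟨fun h' => hx.prop ⟨h, h'⟩, fun y hy hxy => hx.le_of_ge (fun h' => hy h'.2) hxy⟩
  · exact hU.2.2 x ⟨h, fun y hy hxy => hx.le_of_ge (fun h' => hy h'.1) hxy⟩

/-- A pointed generalized Priestley space `(X, τ, ≤, X₀, m)`. -/
structure PGPS : Type (u + 1) where
  carrier : Type u
  [partialOrder : PartialOrder carrier]
  [topology : TopologicalSpace carrier]
  [compact : CompactSpace carrier]
  [priestley : PriestleySpace carrier]
  X₀ : Set carrier
  m : carrier
  isTop_m : IsTop m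
  subset_compl : X₀ ⊆ {m}ᶜ
  dense : {m}ᶜ ⊆ closure X₀
  order_dense : ∀ x, x ≠ m → ∃ y ∈ X₀, x ≤ y
  mem_X₀_iff : ∀ x, x ∈ X₀ ↔
    {U | IsAdmissible X₀ U ∧ x ∉ U}.Nonempty ∧
      DirectedOn (· ⊆ ·) {U | IsAdmissible X₀ U ∧ x ∉ U}
  le_iff : ∀ x y, x ≤ y ↔ ∀ U, IsAdmissible X₀ U → x ∈ U → y ∈ U

attribute [instance] PGPS.partialOrder PGPS.topology PGPS.compact PGPS.priestley

namespace PGPS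

instance : CoeSort PGPS.{u} (Type u) := ⟨PGPS.carrier⟩

/-- The admissible clopen upsets of `X`. -/
def admissible (X : PGPS.{u}) : Set (Set X) := {U | IsAdmissible X.X₀ U}

/-- `box R U` is the set of all `x` with `R[x] ⊆ U`. -/
def box {α β : Type u} (R : α → β → Prop) (U : Set β) : Set α := {x | ∀ y, R x y → y ∈ U}

/-- A generalized Priestley morphism. -/
@[ext]
structure Hom (X Y : PGPS.{u}) where
  rel : X → Y → Prop
  separated : ∀ x y, ¬ rel x y → ∃ U ∈ Y.admissible, (∀ z, rel x z → z ∈ U) ∧ y ∉ U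
  box_mem : ∀ U ∈ Y.admissible, box rel U ∈ X.admissible

/-- The composition `S * R`. -/
def compRel {X Y Z : PGPS.{u}} (R : Hom X Y) (S : Hom Y Z) (x : X) (z : Z) : Prop :=
  ∀ U ∈ Z.admissible, x ∈ box R.rel (box S.rel U) → z ∈ U

theorem box_box_inter {X Y Z : PGPS.{u}} (R : Hom X Y) (S : Hom Y Z) {U V : Set Z} {x : X}
    (hU : x ∈ box R.rel (box S.rel U)) (hV : x ∈ box R.rel (box S.rel V)) :
    x ∈ box R.rel (box S.rel (U ∩ V)) :=
  fun y hy z hz => ⟨hU y hy z hz, hV y hy z hz⟩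

theorem box_compRel {X Y Z : PGPS.{u}} (R : Hom X Y) (S : Hom Y Z) {U : Set Z}
    (hU : U ∈ Z.admissible) : box (compRel R S) U = box R.rel (box S.rel U) := by
  ext x
  constructor
  · intro hx
    let ι := {V : Set Z // V ∈ Z.admissible ∧ x ∈ box R.rel (box S.rel V)}
    have : Nonempty ι := ⟨⟨Set.univ, IsAdmissible.univ _, fun _ _ _ _ => Set.mem_univ _⟩⟩
    obtain ⟨V, hV⟩ := exists_subset_nhds_of_isCompact' (ι := ι) (V := fun V : ι => V.1)
      (fun V W : ι => ⟨⟨V.1 ∩ W.1, V.2.1.inter W.2.1, box_box_inter R S V.2.2 W.2.2⟩,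
        Set.inter_subset_left, Set.inter_subset_right⟩)
      (fun V : ι => V.2.1.1.1.isCompact) (fun V : ι => V.2.1.1.1) (U := U) (by
        intro z hz
        exact hU.1.2.mem_nhds (hx z fun V hV hxV => Set.mem_iInter.1 hz ⟨V, hV, hxV⟩))
    exact fun y hy z hz => hV (V.2.2 y hy z hz)
  · exact fun hx z hz => hz U hU hx

/-- A generalized Priestley morphism is determined by its action on admissible clopen upsets. -/
theorem rel_iff {X Y : PGPS.{u}} (R : Hom X Y) (x : X) (y : Y) :
    R.rel x y ↔ ∀ U ∈ Y.admissible, x ∈ box R.rel U → y ∈ U := by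
  constructor
  · exact fun h U _ hx => hx y h
  · intro h
    by_contra hn
    obtain ⟨U, hU, hx, hy⟩ := R.separated x y hn
    exact hy (h U hU hx)

theorem Hom.ext_box {X Y : PGPS.{u}} {R S : Hom X Y}
    (h : ∀ U ∈ Y.admissible, box R.rel U = box S.rel U) : R = S := by
  ext x y
  rw [rel_iff R, rel_iff S]
  exact forall₂_congr fun U hU => by rw [h U hU]

/-- The identity morphism is the order relation. -/
def Hom.id (X : PGPS.{u}) : Hom X X where
  rel x y := x ≤ y
  separated x y h := by
    rw [X.le_iff] at h
    push Not at h
    obtain ⟨U, hU, hx, hy⟩ := h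
    exact ⟨U, hU, fun z hz => hU.2.1 hz hx, hy⟩
  box_mem U hU := by
    have : box (fun x y : X => x ≤ y) U = U :=
      Set.ext fun x => ⟨fun h => h x le_rfl, fun h y hy => hU.2.1 hy h⟩
    rwa [this]

theorem box_id (X : PGPS.{u}) {U : Set X} (hU : U ∈ X.admissible) :
    box (Hom.id X).rel U = U :=
  Set.ext fun x => ⟨fun h => h x le_rfl, fun h _ hy => hU.2.1 hy h⟩

def Hom.comp {X Y Z : PGPS.{u}} (R : Hom X Y) (S : Hom Y Z) : Hom X Z where
  rel := compRel R S
  separated x z h := by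
    simp only [compRel] at h
    push Not at h
    obtain ⟨U, hU, hx, hz⟩ := h
    exact ⟨U, hU, fun w hw => hw U hU hx, hz⟩
  box_mem U hU := by
    rw [box_compRel R S hU]
    exact R.box_mem _ (S.box_mem U hU)

theorem Hom.box_comp {X Y Z : PGPS.{u}} (R : Hom X Y) (S : Hom Y Z) {U : Set Z}
    (hU : U ∈ Z.admissible) : box (R.comp S).rel U = box R.rel (box S.rel U) :=
  box_compRel R S hU

instance : Category PGPS.{u} where
  Hom X Y := Hom X Y
  id X := Hom.id X
  comp R S := R.comp S
  id_comp R := Hom.ext_box fun U hU => by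
    rw [Hom.box_comp _ _ hU, box_id _ (R.box_mem U hU)]
  comp_id R := Hom.ext_box fun U hU => by
    rw [Hom.box_comp _ _ hU, box_id _ hU]
  assoc R S T := Hom.ext_box fun U hU => by
    rw [Hom.box_comp _ _ hU, Hom.box_comp _ _ (T.box_mem U hU), Hom.box_comp _ _ hU,
      Hom.box_comp _ _ hU]

/-- A pointed Priestley space is a pointed generalized Priestley space with `X₀ = X ∖ {m}`. -/
def IsPointedPriestley : ObjectProperty PGPS.{u} := fun X => X.X₀ = {X.m}ᶜ

end PGPS

/-- The category whose objects are pointed generalized Priestley spaces and whose morphisms are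
strong Priestley morphisms. -/
structure PGPSS : Type (u + 1) where
  space : PGPS.{u}

namespace PGPSS

/-- A strong Priestley morphism: an order-preserving map that pulls admissible clopen upsets
back to admissible clopen upsets. -/
@[ext]
structure Hom (X Y : PGPSS.{u}) where
  map : X.space → Y.space
  monotone : Monotone map
  preimage_mem : ∀ U ∈ Y.space.admissible, map ⁻¹' U ∈ X.space.admissible

instance : Category PGPSS.{u} where
  Hom X Y := Hom X Y
  id X := ⟨fun x => x, monotone_id, fun _ hU => hU⟩
  comp f g := ⟨fun x => g.map (f.map x), g.monotone.comp f.monotone,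
    fun U hU => f.preimage_mem _ (g.preimage_mem U hU)⟩

/-- The maps with `f[X₀] ⊆ Y₀`. -/
def PreservesDensePart : MorphismProperty PGPSS.{u} := fun X Y f =>
  ∀ x ∈ X.space.X₀, f.map x ∈ Y.space.X₀

instance : PreservesDensePart.{u}.IsMultiplicative where
  id_mem _ := fun _ hx => hx
  comp_mem _ _ hf hg := fun x hx => hg _ (hf x hx)

end PGPSS

abbrev PGPSP := WideSubcategory PGPSS.PreservesDensePart.{u}

abbrev PPS := PGPS.IsPointedPriestley.{u}.FullSubcategory

abbrev PPSS :=
  ObjectProperty.FullSubcategory (C := PGPSS.{u}) fun X => PGPS.IsPointedPriestley X.space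

abbrev PPSP :=
  ObjectProperty.FullSubcategory (C := PGPSP.{u}) fun X => PGPS.IsPointedPriestley X.obj.space

end PointedPriestley

/-!
The compact elements of an arithmetic frame form a lattice whose order dual has a top and is
distributive. The frame is recovered from it as its frame of ideals, because the compact ideals are
the principal ones, and join-preserving maps that respect compactness are the same as maps of
compact elements preserving finite joins.

The admissible clopen upsets of a pointed Priestley space are its nonempty clopen upsets. They form
a distributive lattice with top, and the space is recovered as the space of prime filters, with the
improper filter as its greatest element. By compactness, a meet-preserving map `g` of admissible
upsets is `box R` for the relation `R` with `R[x]` the intersection of the `U` such that `x ∈ g U`.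
If `g` preserves binary joins, then these `U` form a prime filter, so `R[x]` is the principal upset
of a point `f x`, and `g` is the inverse image map of `f`.

In both cases the smallest class of morphisms is cut out by cofinality of the map of lattices: this
says that the frame map preserves the top, respectively that only `m` is mapped to `m`.
-/

namespace PointedPriestley

section WideSubcategories

variable {C D E : Type*} [Category* C] [Category* D] [Category* E]
  (Q : ObjectProperty D) (W : MorphismProperty D) [W.IsMultiplicative]

/-- The subcategory of `D` on the objects satisfying `Q` and the morphisms satisfying `W`, encoded
as a full subcategory of a wide subcategory. -/
abbrev WideFull :=
  ObjectProperty.FullSubcategory (C := WideSubcategory W) fun X => Q X.obj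

/-- The inclusion into the full subcategory on the same objects. -/
def forgetWide : WideFull Q W ⥤ Q.FullSubcategory :=
  Q.lift (ObjectProperty.ι _ ⋙ wideSubcategoryInclusion W) fun X => X.property

instance : (forgetWide Q W).Faithful where
  map_injective h := ObjectProperty.hom_ext _ (WideSubcategory.hom_ext _ (congrArg (·.hom) h))

instance : (forgetWide Q W).EssSurj where
  mem_essImage X := ⟨⟨⟨X.obj⟩, X.property⟩, ⟨Iso.refl _⟩⟩

variable {Q W}

/-- A functor whose values on morphisms satisfy `W`, with its codomain restricted to `W`. -/
def corestrictWide (F : C ⥤ Q.FullSubcategory) (hF : ∀ {X Y} (f : X ⟶ Y), W (F.map f).hom) :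
    C ⥤ WideFull Q W where
  obj X := ⟨⟨(F.obj X).obj⟩, (F.obj X).property⟩
  map f := ObjectProperty.homMk ⟨(F.map f).hom, hF f⟩
  map_id X := by simp only [F.map_id]; rfl
  map_comp f g := by simp only [F.map_comp]; rfl

theorem isEquivalence_corestrictWide (F : C ⥤ Q.FullSubcategory) [F.Faithful] [F.EssSurj]
    (hF : ∀ {X Y} (g : F.obj X ⟶ F.obj Y), (∃ f, F.map f = g) ↔ W g.hom)
    (hiso : MorphismProperty.isomorphisms D ≤ W) :
    (corestrictWide F fun f => (hF _).1 ⟨f, rfl⟩).IsEquivalence where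
  faithful := ⟨fun h => F.map_injective (ObjectProperty.hom_ext _ (congrArg (·.hom.hom) h))⟩
  full := ⟨fun g => by
    obtain ⟨f, hf⟩ := (hF (ObjectProperty.homMk g.hom.hom)).2 g.hom.property
    exact ⟨f, ObjectProperty.hom_ext _ (WideSubcategory.hom_ext _ (congrArg (·.hom) hf))⟩⟩
  essSurj := ⟨fun Y => by
    let e := Q.ι.mapIso (F.objObjPreimageIso ⟨Y.obj.obj, Y.property⟩)
    have hhom : W e.hom := hiso _ (.infer_property _)
    have hinv : W e.inv := hiso _ (.infer_property _)
    exact ⟨_, ⟨ObjectProperty.isoMk _ (WideSubcategory.isoMk e hhom hinv)⟩⟩⟩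

/-- Two categories equivalent to the same category, one of them contravariantly, are dually
equivalent. -/
noncomputable def dualEquivalence (e : C ≌ D) (e' : Eᵒᵖ ≌ D) : Cᵒᵖ ≌ E :=
  (e.trans e'.symm).op.trans (opOpEquivalence E)

end WideSubcategories

section Order

variable {α β : Type*}

theorem isLUB_insert_of_isLUB_pair [Preorder α] {S : Set α} {a b c : α} (hS : IsLUB S b)
    (hc : IsLUB {a, b} c) : IsLUB (insert a S) c := by
  rw [isLUB_iff_le_iff] at *
  intro d
  simp only [hc d, upperBounds_insert, upperBounds_singleton, Set.mem_inter_iff, Set.mem_Ici, hS d]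

theorem exists_isLUB_and_isLUB_image [Preorder α] [Preorder β] {f : α → β}
    (h : ∀ a b, ∃ c, IsLUB {a, b} c ∧ IsLUB {f a, f b} (f c)) {S : Set α} (hS : S.Finite)
    (hne : S.Nonempty) : ∃ a, IsLUB S a ∧ IsLUB (f '' S) (f a) := by
  induction S, hS using Set.Finite.induction_on with
  | empty => exact absurd hne Set.not_nonempty_empty
  | @insert x S _ _ ih =>
    rcases S.eq_empty_or_nonempty with rfl | hS
    · exact ⟨x, by simp⟩
    · obtain ⟨b, hb, hfb⟩ := ih hS
      obtain ⟨c, hc, hfc⟩ := h x b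
      rw [Set.image_insert_eq]
      exact ⟨c, isLUB_insert_of_isLUB_pair hb hc, isLUB_insert_of_isLUB_pair hfb hfc⟩

theorem isLUB_pair_subtype_iff [SemilatticeSup α] {p : α → Prop} {a b c : Subtype p}
    (h : p (a.1 ⊔ b.1)) : IsLUB {a, b} c ↔ c.1 = a.1 ⊔ b.1 := by
  have hsup : IsLUB {a, b} (⟨a.1 ⊔ b.1, h⟩ : Subtype p) := by
    simp [isLUB_iff_le_iff, upperBounds_insert, ← Subtype.coe_le_coe]
  refine ⟨fun hc => congrArg Subtype.val (hc.unique hsup), fun hc => ?_⟩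
  obtain rfl : c = ⟨a.1 ⊔ b.1, h⟩ := Subtype.ext hc
  exact hsup

theorem isGLB_pair_subtype_iff [SemilatticeInf α] {p : α → Prop} {a b c : Subtype p}
    (h : p (a.1 ⊓ b.1)) : IsGLB {a, b} c ↔ c.1 = a.1 ⊓ b.1 :=
  isLUB_pair_subtype_iff (α := αᵒᵈ) h

end Order

namespace DMS

variable {M N : DMS.{u}}

/-- A map preserving finite meets, as a morphism of distributive meet-semilattices. -/
def ofHom (f : InfTopHom M.obj N.obj) : M ⟶ N := ObjectProperty.homMk f

theorem hom_ext {f g : M ⟶ N} (h : ∀ a, map f a = map g a) : f = g :=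
  ObjectProperty.hom_ext _ (InfTopHom.ext h)

/-- An order isomorphism, as an isomorphism of distributive meet-semilattices. -/
def isoOfOrderIso (e : M.obj ≃o N.obj) : M ≅ N where
  hom := ofHom ⟨⟨e, map_inf e⟩, map_top e⟩
  inv := ofHom ⟨⟨e.symm, map_inf e.symm⟩, map_top e.symm⟩
  hom_inv_id := hom_ext e.symm_apply_apply
  inv_hom_id := hom_ext e.apply_symm_apply

theorem preservesJoins_iff (hM : IsLattice M) (f : M ⟶ N) :
    PreservesJoins f ↔ ∀ a b c, IsLUB {a, b} c → IsLUB {map f a, map f b} (map f c) := by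
  constructor
  · intro h a b c hc
    simpa only [Set.image_pair] using h _ _ (Set.toFinite _) (Set.insert_nonempty _ _) hc
  · intro h S a hS hne ha
    obtain ⟨b, hb, hfb⟩ := exists_isLUB_and_isLUB_image
      (fun a b => (hM a b).imp fun c hc => ⟨hc, h a b c hc⟩) hS hne
    exact ha.unique hb ▸ hfb

theorem preservesJoins_of_liftsUpperBounds {f : M ⟶ N} (hf : LiftsUpperBounds f) :
    PreservesJoins f := by
  refine fun S a hS _ ha => ⟨(OrderHomClass.mono (map f)).mem_upperBounds_image ha.1, ?_⟩
  intro x hx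
  obtain ⟨c, hc, hcx⟩ := hf S x hS hx
  exact (OrderHomClass.mono (map f) (ha.2 hc)).trans hcx

theorem liftsUpperBounds_iff (hM : IsLattice M) (f : M ⟶ N) :
    LiftsUpperBounds f ↔ PreservesJoins f ∧ ∀ y, ∃ x, map f x ≤ y := by
  constructor
  · intro h
    refine ⟨preservesJoins_of_liftsUpperBounds h, fun y => ?_⟩
    obtain ⟨x, -, hx⟩ := h ∅ y Set.finite_empty (by simp)
    exact ⟨x, hx⟩
  · rintro ⟨hjoin, hcofinal⟩ S x hS hx
    rcases S.eq_empty_or_nonempty with rfl | hne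
    · obtain ⟨c, hc⟩ := hcofinal x
      exact ⟨c, by simp, hc⟩
    · obtain ⟨a, ha, hfa⟩ := exists_isLUB_and_isLUB_image
        (fun a b => (hM a b).imp fun c hc => ⟨hc, (preservesJoins_iff hM f).1 hjoin a b c hc⟩)
        hS hne
      exact ⟨a, ha.1, hfa.2 hx⟩

theorem isomorphisms_le_liftsUpperBounds :
    MorphismProperty.isomorphisms DMS.{u} ≤ LiftsUpperBounds := by
  intro M N f (_ : IsIso f) S x _ hx
  have hinv (a : M.obj) : map (inv f) (map f a) = a :=
    congrArg (map · a) (IsIso.hom_inv_id f)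
  refine ⟨map (inv f) x, fun s hs => ?_, (congrArg (map · x) (IsIso.inv_hom_id f)).le⟩
  exact (hinv s).ge.trans (OrderHomClass.mono (map (inv f)) (hx ⟨s, hs, rfl⟩))

theorem isomorphisms_le_preservesJoins :
    MorphismProperty.isomorphisms DMS.{u} ≤ PreservesJoins :=
  fun _ _ _ hf => preservesJoins_of_liftsUpperBounds (isomorphisms_le_liftsUpperBounds _ hf)

/-- The distributive lattice structure of a distributive meet-semilattice that is a lattice. -/
noncomputable abbrev distribLattice (hM : IsLattice M) : DistribLattice M.obj :=
  letI : Lattice M.obj :=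
    { M.obj.isSemilatticeInf with
      sup := fun a b => (hM a b).choose
      le_sup_left := fun a b => (hM a b).choose_spec.1 (by simp)
      le_sup_right := fun a b => (hM a b).choose_spec.1 (by simp)
      sup_le := fun a b c ha hb => (hM a b).choose_spec.2 (by simp [ha, hb]) }
  { (inferInstance : Lattice M.obj) with
    le_sup_inf := fun x y z => by
      obtain ⟨b, c, hb, hc, h⟩ := M.property y z (x ⊔ y ⊓ z) le_sup_right
      have hx : x ≤ b ⊓ c := h ▸ le_sup_left
      rw [← h]
      exact inf_le_inf (sup_le (hx.trans inf_le_left) hb) (sup_le (hx.trans inf_le_right) hc) }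

end DMS

section CompactElements

theorem isCompactElement_bot {α : Type*} [PartialOrder α] [OrderBot α] :
    IsCompactElement (⊥ : α) :=
  fun _ _ ⟨x, hx⟩ _ _ _ => ⟨x, hx, bot_le⟩

theorem isCompactElement_sup {α : Type*} [SemilatticeSup α] {a b : α}
    (ha : IsCompactElement a) (hb : IsCompactElement b) : IsCompactElement (a ⊔ b) := by
  intro s u hs hd hu hab
  obtain ⟨x, hx, hax⟩ := ha s u hs hd hu (le_sup_left.trans hab)
  obtain ⟨y, hy, hby⟩ := hb s u hs hd hu (le_sup_right.trans hab)
  obtain ⟨z, hz, hxz, hyz⟩ := hd x hx y hy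
  exact ⟨z, hz, sup_le (hax.trans hxz) (hby.trans hyz)⟩

/-- The compact elements of a complete lattice, with the order, bottom and binary joins of the
lattice. -/
abbrev Compacts (α : Type*) [CompleteLattice α] : Type _ := {k : α // IsCompactElement k}

variable {α β : Type*} [CompleteLattice α] [CompleteLattice β]

instance : SemilatticeSup (Compacts α) :=
  Subtype.semilatticeSup fun _ _ => isCompactElement_sup

instance : OrderBot (Compacts α) :=
  Subtype.orderBot isCompactElement_bot

theorem Compacts.coe_le_sSup_image_iff (I : Order.Ideal (Compacts α)) (k : Compacts α) :
    k.1 ≤ sSup (Subtype.val '' (I : Set (Compacts α))) ↔ k ∈ I := by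
  constructor
  · intro h
    obtain ⟨_, ⟨l, hl, rfl⟩, hkl⟩ := k.2 _ _ (I.nonempty.image _)
      (I.directed.mono_comp fun _ _ h => h) (isLUB_sSup _) h
    exact I.lower hkl hl
  · exact fun h => le_sSup ⟨k, h, rfl⟩

/-- The ideal of all elements whose image under a map preserving finite joins is below `b`. -/
def idealBelow {P Q : Type*} [SemilatticeSup P] [OrderBot P] [SemilatticeSup Q] [OrderBot Q]
    (g : SupBotHom P Q) (b : Q) : Order.Ideal P where
  carrier := {k | g k ≤ b}
  lower' _ _ hlk hk := (OrderHomClass.mono g hlk).trans hk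
  nonempty' := ⟨⊥, (map_bot g).trans_le bot_le⟩
  directed' k hk l hl := ⟨k ⊔ l, (map_sup g k l).trans_le (sup_le hk hl), le_sup_left, le_sup_right⟩

/-- The ideal of compact elements below `a`. -/
def compactsBelow (a : α) : Order.Ideal (Compacts α) :=
  idealBelow ⟨⟨Subtype.val, fun _ _ => rfl⟩, rfl⟩ a

theorem sSup_compactsBelow [IsCompactlyGenerated α] (a : α) :
    sSup (Subtype.val '' (compactsBelow a : Set (Compacts α))) = a :=
  le_antisymm (sSup_le (by rintro _ ⟨k, hk, rfl⟩; exact hk))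
    (le_iff_compact_le_imp.2 fun k hk hka => le_sSup ⟨⟨k, hk⟩, hka, rfl⟩)

variable [IsCompactlyGenerated α]

theorem map_eq_sSup_compactsBelow (f : sSupHom α β) (a : α) :
    f a = sSup ((fun k : Compacts α => f k) '' compactsBelow a) := by
  rw [← Set.image_image f Subtype.val, ← map_sSup, sSup_compactsBelow]

theorem exists_compact_le_map (f : sSupHom α β) {a : α} {c : β} (hc : IsCompactElement c)
    (h : c ≤ f a) : ∃ k : Compacts α, k.1 ≤ a ∧ c ≤ f k := by
  rw [map_eq_sSup_compactsBelow] at h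
  obtain ⟨_, ⟨k, hka, rfl⟩, hck⟩ := hc _ _ ((compactsBelow a).nonempty.image _)
    ((compactsBelow a).directed.mono_comp fun _ _ h => OrderHomClass.mono f h) (isLUB_sSup _) h
  exact ⟨k, hka, hck⟩

theorem sSupHom_ext_of_compact {f g : sSupHom α β} (h : ∀ k : Compacts α, f k = g k) : f = g := by
  ext a
  rw [map_eq_sSup_compactsBelow f, map_eq_sSup_compactsBelow g, Set.image_congr fun k _ => h k]

/-- The extension of a map of compact elements to a map that preserves arbitrary joins. -/
def extendCompacts (g : SupBotHom (Compacts α) β) : sSupHom α β where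
  toFun a := sSup (g '' compactsBelow a)
  map_sSup' := by
    have gc : GaloisConnection (fun a => sSup (g '' compactsBelow a))
        (fun b => sSup (Subtype.val '' (idealBelow g b : Set (Compacts α)))) := by
      intro a b
      rw [sSup_le_iff, Set.forall_mem_image, le_iff_compact_le_imp]
      exact ⟨fun h k hk hka => (Compacts.coe_le_sSup_image_iff (idealBelow g b) ⟨k, hk⟩).2 (h hka),
        fun h k hka => (Compacts.coe_le_sSup_image_iff (idealBelow g b) k).1 (h k k.2 hka)⟩
    exact fun s => gc.l_sSup.trans sSup_image.symm

theorem extendCompacts_coe (g : SupBotHom (Compacts α) β) (k : Compacts α) :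
    extendCompacts g k = g k :=
  le_antisymm (sSup_le (by rintro _ ⟨l, hl, rfl⟩; exact OrderHomClass.mono g hl))
    (le_sSup ⟨k, le_rfl, rfl⟩)

theorem map_top_eq_top_iff [IsCompactlyGenerated β] (f : sSupHom α β) :
    f ⊤ = ⊤ ↔ ∀ c : Compacts β, ∃ k : Compacts α, c.1 ≤ f k := by
  rw [eq_top_iff, le_iff_compact_le_imp]
  constructor
  · intro h c
    obtain ⟨k, -, hck⟩ := exists_compact_le_map f c.2 (h c c.2 le_top)
    exact ⟨k, hck⟩
  · intro h c hc _
    obtain ⟨k, hck⟩ := h ⟨c, hc⟩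
    exact hck.trans (OrderHomClass.mono f le_top)

theorem map_inf_of_compact [IsCompactlyGenerated β] {f : sSupHom α β}
    (h : ∀ k l : Compacts α, f (k.1 ⊓ l.1) = f k ⊓ f l) (a b : α) : f (a ⊓ b) = f a ⊓ f b := by
  refine le_antisymm ((OrderHomClass.mono f).map_inf_le a b) ?_
  rw [le_iff_compact_le_imp]
  intro c hc hcab
  obtain ⟨k, hka, hck⟩ := exists_compact_le_map f hc (hcab.trans inf_le_left)
  obtain ⟨l, hlb, hcl⟩ := exists_compact_le_map f hc (hcab.trans inf_le_right)
  exact (le_inf hck hcl).trans ((h k l).ge.trans (OrderHomClass.mono f (inf_le_inf hka hlb)))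

end CompactElements

namespace AlgFrmJ

variable {L M : AlgFrmJ.{u}} (hL : IsArithmetic L) (hM : IsArithmetic M)

/-- The order dual of the join-semilattice of compact elements of an arithmetic frame. -/
def compactsDual (L : AlgFrmJ.{u}) (hL : IsArithmetic L) : DMS.{u} where
  obj := SemilatInfCat.of (Compacts L)ᵒᵈ
  property := fun (a b c : Compacts L) (h : c.1 ≤ a.1 ⊔ b.1) =>
    ⟨(⟨a.1 ⊓ c.1, hL _ _ a.2 c.2⟩ : Compacts L), (⟨b.1 ⊓ c.1, hL _ _ b.2 c.2⟩ : Compacts L),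
      (inf_le_left : a.1 ⊓ c.1 ≤ a.1), (inf_le_left : b.1 ⊓ c.1 ≤ b.1),
      Subtype.ext (((inf_sup_right a.1 b.1 c.1).symm.trans (inf_eq_right.2 h)))⟩

theorem isLUB_compactsDual_iff {a b c : (L.compactsDual hL).obj} :
    IsLUB {a, b} c ↔ (c : Compacts L).1 = (a : Compacts L).1 ⊓ (b : Compacts L).1 :=
  isGLB_pair_subtype_iff (hL _ _ (a : Compacts L).2 (b : Compacts L).2)

theorem isLattice_compactsDual : DMS.IsLattice (L.compactsDual hL) :=
  fun (a b : Compacts L) => ⟨(⟨a.1 ⊓ b.1, hL _ _ a.2 b.2⟩ : Compacts L),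
    (isLUB_compactsDual_iff hL).2 rfl⟩

/-- The restriction of a morphism to compact elements. -/
def restrictCompacts (f : L ⟶ M) : L.compactsDual hL ⟶ M.compactsDual hM :=
  DMS.ofHom <| SupBotHom.dual
    { toFun := fun k : Compacts L => (⟨f.map k.1, f.map_compact k.1 k.2⟩ : Compacts M)
      map_sup' := fun k l => Subtype.ext (map_sup f.map k.1 l.1)
      map_bot' := Subtype.ext (map_bot f.map) }

theorem restrictCompacts_injective : Function.Injective (restrictCompacts hL hM) :=
  fun _ _ h => Hom.ext <| sSupHom_ext_of_compact fun k =>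
    congrArg (fun φ => (DMS.map φ (OrderDual.toDual k) : Compacts M).1) h

theorem restrictCompacts_surjective : Function.Surjective (restrictCompacts hL hM) := by
  intro g
  let g₀ : SupBotHom (Compacts L) (Compacts M) := SupBotHom.dual.symm (DMS.map g)
  let g₁ : SupBotHom (Compacts L) M :=
    { toFun := fun k => (g₀ k).1
      map_sup' := fun k l => congrArg Subtype.val (map_sup g₀ k l)
      map_bot' := congrArg Subtype.val (map_bot g₀) }
  refine ⟨⟨extendCompacts g₁, fun k hk => ?_⟩, DMS.hom_ext fun k => Subtype.ext ?_⟩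
  · rw [extendCompacts_coe g₁ ⟨k, hk⟩]
    exact (g₀ ⟨k, hk⟩).2
  · exact extendCompacts_coe g₁ k

variable {hL hM}

theorem preservesJoins_restrictCompacts_iff {f : L ⟶ M} :
    DMS.PreservesJoins (restrictCompacts hL hM f) ↔
      ∀ k l : Compacts L, f.map (k.1 ⊓ l.1) = f.map k ⊓ f.map l := by
  simp only [DMS.preservesJoins_iff (isLattice_compactsDual hL), isLUB_compactsDual_iff]
  constructor
  · exact fun h k l => h k l (⟨k.1 ⊓ l.1, hL _ _ k.2 l.2⟩ : Compacts L) rfl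
  · exact fun h k l c hc => (congrArg f.map hc).trans (h k l)

theorem liftsUpperBounds_restrictCompacts_iff {f : L ⟶ M} :
    DMS.LiftsUpperBounds (restrictCompacts hL hM f) ↔
      (∀ k l : Compacts L, f.map (k.1 ⊓ l.1) = f.map k ⊓ f.map l) ∧ f.map ⊤ = ⊤ := by
  rw [DMS.liftsUpperBounds_iff (isLattice_compactsDual hL), preservesJoins_restrictCompacts_iff,
    map_top_eq_top_iff]
  rfl

theorem preservesCompactMeets_iff (hL : IsArithmetic L) {f : L ⟶ M} :
    PreservesCompactMeets f ↔
      ∀ k l : Compacts L, f.map (k.1 ⊓ l.1) = f.map k ⊓ f.map l := by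
  constructor
  · intro h k l
    have hkl : ∀ s ∈ ({k.1, l.1} : Set L), IsCompactElement s := by simp [k.2, l.2]
    have hinf : IsCompactElement (sInf {k.1, l.1}) := by
      rw [sInf_pair]
      exact hL _ _ k.2 l.2
    simpa only [Set.image_pair, sInf_pair] using
      h {k.1, l.1} (Set.toFinite _) (Set.insert_nonempty _ _) hkl hinf
  · intro h S hS hne hc hk
    suffices IsCompactElement (sInf S) ∧ f.map (sInf S) = sInf (f.map '' S) from this.2
    clear hk
    induction S, hS using Set.Finite.induction_on with
    | empty => exact absurd hne Set.not_nonempty_empty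
    | @insert x S _ _ ih =>
      obtain ⟨hx, hxS⟩ := Set.forall_mem_insert.1 hc
      rcases S.eq_empty_or_nonempty with rfl | hne
      · simpa using hx
      · obtain ⟨hk, hf⟩ := ih hne hxS
        rw [Set.image_insert_eq, sInf_insert, sInf_insert, h ⟨x, hx⟩ ⟨_, hk⟩, hf]
        exact ⟨hL _ _ hx hk, rfl⟩

theorem preservesFiniteMeets_iff {f : L ⟶ M} :
    PreservesFiniteMeets f ↔ (∀ a b, f.map (a ⊓ b) = f.map a ⊓ f.map b) ∧ f.map ⊤ = ⊤ := by
  constructor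
  · intro h
    refine ⟨fun a b => ?_, ?_⟩
    · simpa only [Set.image_pair, sInf_pair] using h {a, b} (Set.toFinite _)
    · simpa only [Set.image_empty, sInf_empty] using h ∅ Set.finite_empty
  · rintro ⟨hinf, htop⟩ S hS
    induction S, hS using Set.Finite.induction_on with
    | empty => rw [Set.image_empty, sInf_empty, sInf_empty, htop]
    | insert _ _ ih => rw [Set.image_insert_eq, sInf_insert, sInf_insert, hinf, ih]

theorem preservesJoins_restrictCompacts_iff_preservesCompactMeets {f : L ⟶ M} :
    DMS.PreservesJoins (restrictCompacts hL hM f) ↔ PreservesCompactMeets f :=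
  preservesJoins_restrictCompacts_iff.trans (preservesCompactMeets_iff hL).symm

theorem liftsUpperBounds_restrictCompacts_iff_preservesFiniteMeets {f : L ⟶ M} :
    DMS.LiftsUpperBounds (restrictCompacts hL hM f) ↔ PreservesFiniteMeets f := by
  rw [liftsUpperBounds_restrictCompacts_iff, preservesFiniteMeets_iff]
  exact and_congr_left fun _ => ⟨map_inf_of_compact, fun h k l => h k l⟩

end AlgFrmJ

section Ideals

section Preorder

variable {P : Type*} [Preorder P]

theorem isLUB_image_principal (I : Order.Ideal P) :
    IsLUB (Order.Ideal.principal '' (I : Set P)) I := by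
  simp only [isLUB_iff_le_iff, mem_upperBounds, Set.forall_mem_image, Order.Ideal.principal_le_iff]
  exact fun J => Iff.rfl

theorem isCompactElement_principal (p : P) : IsCompactElement (Order.Ideal.principal p) := by
  intro S I hne hdir hI hp
  have hideal : Order.IsIdeal (⋃₀ (SetLike.coe '' S) : Set P) :=
    Order.isIdeal_sUnion_of_directedOn (by rintro _ ⟨J, _, rfl⟩; exact J.isIdeal)
      (hdir.mono_comp fun _ _ h => h) (hne.image _)
  have hle : I ≤ hideal.toIdeal := hI.2 fun J hJ x hx => ⟨J, ⟨J, hJ, rfl⟩, hx⟩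
  obtain ⟨_, ⟨J, hJ, rfl⟩, hpJ⟩ := hle (Order.Ideal.principal_le_iff.1 hp)
  exact ⟨J, hJ, Order.Ideal.principal_le_iff.2 hpJ⟩

theorem isCompactElement_ideal_iff {I : Order.Ideal P} :
    IsCompactElement I ↔ ∃ p, Order.Ideal.principal p = I := by
  constructor
  · intro h
    obtain ⟨_, ⟨p, hp, rfl⟩, hIp⟩ := h _ I (I.nonempty.image _)
      (I.directed.mono_comp fun _ _ h => Order.Ideal.principal_le_iff.2 h)
      (isLUB_image_principal I) le_rfl
    exact ⟨p, le_antisymm (Order.Ideal.principal_le_iff.2 hp) hIp⟩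
  · rintro ⟨p, rfl⟩
    exact isCompactElement_principal p

end Preorder

variable {P : Type*} [DistribLattice P] [OrderBot P]

/-- The relative pseudocomplement of ideals. -/
def idealHimp (I J : Order.Ideal P) : Order.Ideal P where
  carrier := {x | ∀ y ∈ I, x ⊓ y ∈ J}
  lower' _ _ hba ha y hy := J.lower (inf_le_inf_right y hba) (ha y hy)
  nonempty' := ⟨⊥, fun y _ => by simp⟩
  directed' a ha b hb := ⟨a ⊔ b, fun y hy => by
    rw [inf_sup_right]
    exact Order.Ideal.sup_mem (ha y hy) (hb y hy), le_sup_left, le_sup_right⟩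

theorem le_idealHimp_iff (I J K : Order.Ideal P) : I ≤ idealHimp J K ↔ I ⊓ J ≤ K :=
  ⟨fun h _ hx => K.lower (le_inf le_rfl le_rfl) (h hx.1 _ hx.2),
    fun h _ hx _ hy => h ⟨I.lower inf_le_left hx, J.lower inf_le_right hy⟩⟩

/-- The frame of ideals of a distributive lattice with bottom. -/
abbrev idealFrame (P : Type*) [DistribLattice P] [OrderBot P] : Order.Frame (Order.Ideal P) :=
  { (inferInstance : CompleteLattice (Order.Ideal P)) with
    himp := idealHimp
    le_himp_iff := le_idealHimp_iff
    compl := fun I => idealHimp I ⊥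
    himp_bot := fun _ => rfl }

end Ideals

namespace AlgFrmJ

/-- The algebraic frame of ideals of a distributive lattice with bottom. -/
def ofIdeals (P : Type u) [DistribLattice P] [OrderBot P] : AlgFrmJ.{u} :=
  letI := idealFrame P
  { carrier := Order.Ideal P
    algebraic := ⟨fun I => ⟨_, Set.forall_mem_image.2 fun p _ => isCompactElement_principal p,
      (isLUB_image_principal I).sSup_eq⟩⟩ }

theorem isArithmetic_ofIdeals (P : Type u) [DistribLattice P] [OrderBot P] :
    IsArithmetic (ofIdeals P) := by
  intro (I : Order.Ideal P) (J : Order.Ideal P) hI hJ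
  obtain ⟨p, rfl⟩ := isCompactElement_ideal_iff.1 hI
  obtain ⟨q, rfl⟩ := isCompactElement_ideal_iff.1 hJ
  exact isCompactElement_ideal_iff.2 ⟨p ⊓ q, Order.Ideal.ext (Set.ext fun _ => le_inf_iff)⟩

/-- Principal ideals identify a distributive lattice with the compact elements of its frame of
ideals. -/
noncomputable def principalOrderIso (P : Type u) [DistribLattice P] [OrderBot P] :
    P ≃o Compacts (ofIdeals P) :=
  .ofSurjective
    (OrderEmbedding.ofMapLEIff
      (fun p => (⟨Order.Ideal.principal p, isCompactElement_principal p⟩ : Compacts (ofIdeals P)))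
      fun _ _ => Order.Ideal.principal_le_iff)
    fun k => (isCompactElement_ideal_iff.1 k.2).imp fun _ h => Subtype.ext h

/-- Every distributive lattice with top is dual to the lattice of compact elements of the frame of
ideals of its order dual. -/
noncomputable def compactsDualOfIdealsIso {M : DMS.{u}} (hM : DMS.IsLattice M) :
    letI := M.distribLattice hM
    (ofIdeals M.objᵒᵈ).compactsDual (isArithmetic_ofIdeals _) ≅ M :=
  letI := DMS.distribLattice hM
  DMS.isoOfOrderIso ((OrderIso.dualDual M.obj).trans (principalOrderIso M.objᵒᵈ).dual).symm

/-- The functor sending an arithmetic frame to the order dual of its lattice of compact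
elements. -/
def toDLM : ArFrmJ.{u} ⥤ DLM.{u} where
  obj L := ⟨L.obj.compactsDual L.property, isLattice_compactsDual L.property⟩
  map {L M} f := ObjectProperty.homMk (restrictCompacts L.property M.property f.hom)

instance : toDLM.{u}.IsEquivalence where
  faithful := ⟨fun h =>
    ObjectProperty.hom_ext _ (restrictCompacts_injective _ _ (congrArg (·.hom) h))⟩
  full := ⟨fun g => by
    obtain ⟨f, hf⟩ := restrictCompacts_surjective _ _ g.hom
    exact ⟨ObjectProperty.homMk f, ObjectProperty.hom_ext _ hf⟩⟩
  essSurj := ⟨fun M =>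
    letI := DMS.distribLattice M.property
    ⟨⟨ofIdeals M.obj.objᵒᵈ, isArithmetic_ofIdeals _⟩,
      ⟨ObjectProperty.isoMk _ (compactsDualOfIdealsIso M.property)⟩⟩⟩

theorem exists_toDLM_map_eq_iff_preservesJoins {L M : ArFrmS.{u}}
    (g : (forgetWide _ _ ⋙ toDLM).obj L ⟶ (forgetWide _ _ ⋙ toDLM).obj M) :
    (∃ f : L ⟶ M, (forgetWide _ _ ⋙ toDLM).map f = g) ↔ DMS.PreservesJoins g.hom := by
  constructor
  · rintro ⟨f, rfl⟩
    exact preservesJoins_restrictCompacts_iff_preservesCompactMeets.2 f.hom.property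
  · intro hg
    obtain ⟨f, rfl⟩ := toDLM.map_surjective g
    exact ⟨ObjectProperty.homMk
      ⟨f.hom, preservesJoins_restrictCompacts_iff_preservesCompactMeets.1 hg⟩, rfl⟩

theorem exists_toDLM_map_eq_iff_liftsUpperBounds {L M : ArFrm.{u}}
    (g : (forgetWide _ _ ⋙ toDLM).obj L ⟶ (forgetWide _ _ ⋙ toDLM).obj M) :
    (∃ f : L ⟶ M, (forgetWide _ _ ⋙ toDLM).map f = g) ↔ DMS.LiftsUpperBounds g.hom := by
  constructor
  · rintro ⟨f, rfl⟩
    exact liftsUpperBounds_restrictCompacts_iff_preservesFiniteMeets.2 f.hom.property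
  · intro hg
    obtain ⟨f, rfl⟩ := toDLM.map_surjective g
    exact ⟨ObjectProperty.homMk
      ⟨f.hom, liftsUpperBounds_restrictCompacts_iff_preservesFiniteMeets.1 hg⟩, rfl⟩

/-- The functor `toDLM` on the morphisms preserving compact meets of compact elements. -/
def toDL : ArFrmS.{u} ⥤ DL.{u} :=
  corestrictWide (forgetWide _ _ ⋙ toDLM) fun f =>
    (exists_toDLM_map_eq_iff_preservesJoins _).1 ⟨f, rfl⟩

instance : toDL.{u}.IsEquivalence :=
  isEquivalence_corestrictWide _ exists_toDLM_map_eq_iff_preservesJoins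
    DMS.isomorphisms_le_preservesJoins

/-- The functor `toDLM` on frame homomorphisms. -/
def toDLP : ArFrm.{u} ⥤ DLP.{u} :=
  corestrictWide (forgetWide _ _ ⋙ toDLM) fun f =>
    (exists_toDLM_map_eq_iff_liftsUpperBounds _).1 ⟨f, rfl⟩

instance : toDLP.{u}.IsEquivalence :=
  isEquivalence_corestrictWide _ exists_toDLM_map_eq_iff_liftsUpperBounds
    DMS.isomorphisms_le_liftsUpperBounds

end AlgFrmJ

section Compactness

variable {X P : Type*} [TopologicalSpace X] [Preorder P] {φ : P → Set X} {D : Set P}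

theorem exists_subset_of_biInter_subset [CompactSpace X] (hφ : Monotone φ)
    (hclosed : ∀ a, IsClosed (φ a)) (hne : D.Nonempty) (hD : DirectedOn (· ≥ ·) D) {U : Set X}
    (hU : IsOpen U) (h : ⋂ a ∈ D, φ a ⊆ U) : ∃ a ∈ D, φ a ⊆ U := by
  have : Nonempty D := hne.to_subtype
  obtain ⟨a, ha⟩ := exists_subset_nhds_of_isCompact' (V := fun a : D => φ a)
    (hD.directed_val.mono_comp _ fun _ _ hab => hφ hab) (fun a => (hclosed a).isCompact)
    (fun a => hclosed a) (U := U)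
    (fun x hx => hU.mem_nhds (h (by rwa [Set.biInter_eq_iInter])))
  exact ⟨a, a.2, ha⟩

theorem exists_subset_of_subset_biUnion (hφ : Monotone φ) (hopen : ∀ a, IsOpen (φ a))
    (hne : D.Nonempty) (hD : DirectedOn (· ≤ ·) D) {K : Set X} (hK : IsCompact K)
    (h : K ⊆ ⋃ a ∈ D, φ a) : ∃ a ∈ D, K ⊆ φ a := by
  have : Nonempty D := hne.to_subtype
  obtain ⟨a, ha⟩ := hK.elim_directed_cover (fun a : D => φ a) (fun a => hopen a)
    (by rwa [← Set.biUnion_eq_iUnion D fun a _ => φ a])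
    (hD.directed_val.mono_comp _ fun _ _ hab => hφ hab)
  exact ⟨a, a.2, ha⟩

theorem exists_forall_mem_iff_of_isPrime [CompactSpace X] (φ : P ↪o Set X)
    (hφ : ∀ a, IsClopen (φ a)) (F : Order.PFilter P) (hF : F.IsPrime) :
    ∃ x, ∀ a, x ∈ φ a ↔ a ∈ F := by
  by_contra! hx
  have hcover : ⋂ a ∈ (F : Set P), φ a ⊆ ⋃ b ∈ (F : Set P)ᶜ, φ b := by
    intro x hxF
    obtain ⟨b, ⟨hxb, hb⟩ | ⟨hxb, hb⟩⟩ := hx x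
    · exact Set.mem_biUnion hb hxb
    · exact absurd (Set.mem_iInter₂.1 hxF b hb) hxb
  obtain ⟨a, ha, haF⟩ := exists_subset_of_biInter_subset φ.monotone (fun a => (hφ a).1)
    F.nonempty F.directed (isOpen_biUnion fun b _ => (hφ b).2) hcover
  obtain ⟨b, hb, hab⟩ := exists_subset_of_subset_biUnion φ.monotone (fun b => (hφ b).2)
    hF.compl_ideal.Nonempty hF.compl_ideal.Directed (hφ a).1.isCompact haF
  exact hb (Order.PFilter.mem_of_le (φ.le_iff_le.1 hab) ha)

end Compactness

section IsTop

variable {α : Type u} [PartialOrder α] [TopologicalSpace α] {m : α}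

theorem isAdmissible_compl_singleton_iff (hm : IsTop m) {U : Set α} :
    IsAdmissible {m}ᶜ U ↔ IsClopen U ∧ IsUpperSet U ∧ m ∈ U := by
  refine ⟨fun h => ⟨h.1, h.2.1, by_contra fun hmU => ?_⟩,
    fun h => ⟨h.1, h.2.1, fun x hx hxm => hx.prop (hxm ▸ h.2.2)⟩⟩
  exact h.2.2 m ⟨hmU, fun y _ _ => hm y⟩ rfl

theorem IsAdmissible.union_of_isTop (hm : IsTop m) {U V : Set α} (hU : IsAdmissible {m}ᶜ U)
    (hV : IsAdmissible {m}ᶜ V) : IsAdmissible {m}ᶜ (U ∪ V) := by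
  rw [isAdmissible_compl_singleton_iff hm] at *
  exact ⟨hU.1.union hV.1, hU.2.1.union hV.2.1, Or.inl hU.2.2⟩

theorem exists_isAdmissible_of_not_le [PriestleySpace α] (hm : IsTop m) {x y : α} (h : ¬ x ≤ y) :
    ∃ U, IsAdmissible {m}ᶜ U ∧ x ∈ U ∧ y ∉ U := by
  obtain ⟨U, hU, hU', hx, hy⟩ := exists_isClopen_upper_of_not_le h
  exact ⟨U, (isAdmissible_compl_singleton_iff hm).2 ⟨hU, hU', hU' (hm x) hx⟩, hx, hy⟩

end IsTop

namespace PGPS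

/-- A compact Priestley space with a greatest element `m`, as a pointed Priestley space. -/
def ofIsTop (α : Type u) [PartialOrder α] [TopologicalSpace α] [CompactSpace α]
    [PriestleySpace α] (m : α) (hm : IsTop m) : PGPS.{u} where
  carrier := α
  X₀ := {m}ᶜ
  m := m
  isTop_m := hm
  subset_compl := subset_rfl
  dense := subset_closure
  order_dense x hx := ⟨x, hx, le_rfl⟩
  mem_X₀_iff x := by
    constructor
    · intro hx
      obtain ⟨U, hU, -, hxU⟩ :=
        exists_isAdmissible_of_not_le hm fun h : m ≤ x => hx (le_antisymm (hm x) h)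
      exact ⟨⟨U, hU, hxU⟩, fun V hV W hW => ⟨V ∪ W, ⟨hV.1.union_of_isTop hm hW.1,
        fun h => h.elim hV.2 hW.2⟩, Set.subset_union_left, Set.subset_union_right⟩⟩
    · rintro ⟨⟨U, hU, hxU⟩, -⟩ rfl
      exact hxU ((isAdmissible_compl_singleton_iff hm).1 hU).2.2
  le_iff x y := by
    refine ⟨fun h U hU hx => hU.2.1 h hx, fun h => by_contra fun hxy => ?_⟩
    obtain ⟨U, hU, hx, hy⟩ := exists_isAdmissible_of_not_le hm hxy
    exact hy (h U hU hx)

/-- The type of admissible clopen upsets of `X`. -/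
abbrev Admissible (X : PGPS.{u}) : Type u := {U : Set X // U ∈ X.admissible}

variable {X Y : PGPS.{u}}

instance : SemilatticeInf X.Admissible := Subtype.semilatticeInf fun _ _ => IsAdmissible.inter

instance : OrderTop X.Admissible := Subtype.orderTop (IsAdmissible.univ _)

theorem mem_admissible_iff (hX : X.IsPointedPriestley) {U : Set X} :
    U ∈ X.admissible ↔ IsClopen U ∧ IsUpperSet U ∧ X.m ∈ U := by
  rw [← isAdmissible_compl_singleton_iff X.isTop_m, ← show X.X₀ = {X.m}ᶜ from hX]
  rfl

theorem union_mem_admissible (hX : X.IsPointedPriestley) {U V : Set X} (hU : U ∈ X.admissible)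
    (hV : V ∈ X.admissible) : U ∪ V ∈ X.admissible := by
  have hX₀ : X.X₀ = {X.m}ᶜ := hX
  simp only [admissible, hX₀] at hU hV ⊢
  exact IsAdmissible.union_of_isTop X.isTop_m hU hV

theorem forall_mem_admissible_iff (hX : X.IsPointedPriestley) {x : X} :
    (∀ U ∈ X.admissible, x ∈ U) ↔ x = X.m := by
  constructor
  · exact fun h => le_antisymm (X.isTop_m x) ((X.le_iff _ _).2 fun U hU _ => h U hU)
  · rintro rfl U hU
    exact ((mem_admissible_iff hX).1 hU).2.2

/-- The distributive meet-semilattice of admissible clopen upsets of a pointed Priestley space. -/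
def admissibleDMS (hX : X.IsPointedPriestley) : DMS.{u} where
  obj := SemilatInfCat.of X.Admissible
  property := fun (U V W : X.Admissible) (h : U.1 ∩ V.1 ⊆ W.1) =>
    ⟨(⟨U.1 ∪ W.1, union_mem_admissible hX U.2 W.2⟩ : X.Admissible),
      (⟨V.1 ∪ W.1, union_mem_admissible hX V.2 W.2⟩ : X.Admissible),
      (Set.subset_union_left : U.1 ⊆ U.1 ∪ W.1), (Set.subset_union_left : V.1 ⊆ V.1 ∪ W.1),
      Subtype.ext ((Set.inter_union_distrib_right U.1 V.1 W.1).symm.trans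
        (Set.union_eq_self_of_subset_left h))⟩

theorem isLUB_admissibleDMS_iff (hX : X.IsPointedPriestley) {U V W : (admissibleDMS hX).obj} :
    IsLUB {U, V} W ↔ (W : X.Admissible).1 = (U : X.Admissible).1 ∪ (V : X.Admissible).1 :=
  isLUB_pair_subtype_iff
    (union_mem_admissible hX (U : X.Admissible).2 (V : X.Admissible).2)

theorem isLattice_admissibleDMS (hX : X.IsPointedPriestley) :
    DMS.IsLattice (admissibleDMS hX) :=
  fun (U V : X.Admissible) => ⟨(⟨U.1 ∪ V.1, union_mem_admissible hX U.2 V.2⟩ : X.Admissible),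
    (isLUB_admissibleDMS_iff hX).2 rfl⟩

/-- The filter of all `a` such that `x ∈ g a`. -/
def filterAt {P : Type*} [SemilatticeInf P] [OrderTop P] (g : InfTopHom P X.Admissible) (x : X) :
    Order.PFilter P :=
  Order.IsPFilter.toPFilter (F := {a | x ∈ (g a).1}) <| .of_def
    ⟨⊤, by rw [Set.mem_ofPred_eq, map_top]; exact Set.mem_univ x⟩
    (fun a ha b hb => ⟨a ⊓ b, by rw [Set.mem_ofPred_eq, map_inf]; exact ⟨ha, hb⟩,
      inf_le_left, inf_le_right⟩)
    (fun hab ha => OrderHomClass.mono g hab ha)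

/-- The relation `R` with `R[x]` the intersection of all admissible `U` such that `x ∈ g U`. -/
def relOfInfTopHom (g : InfTopHom Y.Admissible X.Admissible) (x : X) (y : Y) : Prop :=
  ∀ U ∈ filterAt g x, y ∈ U.1

theorem box_relOfInfTopHom (g : InfTopHom Y.Admissible X.Admissible) (U : Y.Admissible) :
    box (relOfInfTopHom g) U.1 = (g U).1 := by
  refine Set.Subset.antisymm (fun x hx => ?_) fun x hx y hy => hy U hx
  obtain ⟨V, hxV, hVU⟩ := exists_subset_of_biInter_subset (φ := fun V : Y.Admissible => V.1)
    (fun _ _ h => h) (fun V => V.2.1.1) (filterAt g x).nonempty (filterAt g x).directed U.2.1.2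
    (fun y hy => hx y fun V hV => Set.mem_iInter₂.1 hy V hV)
  exact OrderHomClass.mono g (show V ≤ U from hVU) hxV

/-- Generalized Priestley morphisms correspond to maps preserving finite meets of admissible
clopen upsets. -/
def boxEquiv : Hom X Y ≃ InfTopHom Y.Admissible X.Admissible where
  toFun R :=
    { toFun := fun U => ⟨box R.rel U.1, R.box_mem U.1 U.2⟩
      map_inf' := fun _ _ => Subtype.ext <| Set.ext fun _ =>
        ⟨fun h => ⟨fun y hy => (h y hy).1, fun y hy => (h y hy).2⟩,
          fun h y hy => ⟨h.1 y hy, h.2 y hy⟩⟩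
      map_top' := Subtype.ext <| Set.eq_univ_of_forall fun _ y _ => Set.mem_univ y }
  invFun g :=
    { rel := relOfInfTopHom g
      separated := fun x y hxy => by
        simp only [relOfInfTopHom, not_forall] at hxy
        obtain ⟨U, hxU, hyU⟩ := hxy
        exact ⟨U.1, U.2, fun z hz => hz U hxU, hyU⟩
      box_mem := fun U hU => box_relOfInfTopHom g ⟨U, hU⟩ ▸ (g ⟨U, hU⟩).2 }
  left_inv _ := Hom.ext_box fun U hU => box_relOfInfTopHom _ ⟨U, hU⟩
  right_inv g := InfTopHom.ext fun U => Subtype.ext (box_relOfInfTopHom g U)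

end PGPS

namespace PGPSS

open PGPS

variable {X Y : PGPSS.{u}}

/-- The inverse image map on admissible clopen upsets induced by a strong Priestley morphism. -/
def preimageHom (f : X ⟶ Y) : InfTopHom Y.space.Admissible X.space.Admissible where
  toFun U := ⟨f.map ⁻¹' U.1, f.preimage_mem U.1 U.2⟩
  map_inf' _ _ := rfl
  map_top' := rfl

theorem preimageHom_injective : Function.Injective (preimageHom (X := X) (Y := Y)) := by
  intro f g h
  have hpre (U) (hU : U ∈ Y.space.admissible) : f.map ⁻¹' U = g.map ⁻¹' U :=
    congrArg (fun φ : InfTopHom _ _ => (φ ⟨U, hU⟩).1) h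
  refine Hom.ext (funext fun x => le_antisymm ?_ ?_) <;> rw [Y.space.le_iff]
  · exact fun U hU hx => (hpre U hU).subset hx
  · exact fun U hU hx => (hpre U hU).superset hx

theorem exists_preimageHom_eq (g : InfTopHom Y.space.Admissible X.space.Admissible)
    (hg : ∀ x, ∃ y, ∀ U : Y.space.Admissible, y ∈ U.1 ↔ x ∈ (g U).1) :
    ∃ f : X ⟶ Y, preimageHom f = g := by
  choose f hf using hg
  have hpre (U : Y.space.Admissible) : f ⁻¹' U.1 = (g U).1 := Set.ext fun x => hf x U
  refine ⟨⟨f, fun x y hxy => (Y.space.le_iff _ _).2 fun U hU hx => ?_,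
    fun U hU => hpre ⟨U, hU⟩ ▸ (g ⟨U, hU⟩).2⟩, InfTopHom.ext fun U => Subtype.ext (hpre U)⟩
  exact (hf y ⟨U, hU⟩).2 ((g ⟨U, hU⟩).2.2.1 hxy ((hf x ⟨U, hU⟩).1 hx))

variable (hX : X.space.IsPointedPriestley) (hY : Y.space.IsPointedPriestley)

theorem preservesJoins_iff_map_union (g : InfTopHom Y.space.Admissible X.space.Admissible) :
    DMS.PreservesJoins (DMS.ofHom g : admissibleDMS hY ⟶ admissibleDMS hX) ↔
      ∀ U V : Y.space.Admissible,
        (g ⟨U.1 ∪ V.1, union_mem_admissible hY U.2 V.2⟩).1 = (g U).1 ∪ (g V).1 := by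
  simp only [DMS.preservesJoins_iff (isLattice_admissibleDMS hY), isLUB_admissibleDMS_iff]
  refine ⟨fun h U V => h U V _ rfl, fun h U V W hW => ?_⟩
  obtain rfl : W = (⟨_, union_mem_admissible hY U.2 V.2⟩ : Y.space.Admissible) := Subtype.ext hW
  exact h U V

include hY in
theorem exists_forall_mem_iff_of_map_union {g : InfTopHom Y.space.Admissible X.space.Admissible}
    (hg : ∀ U V : Y.space.Admissible,
      (g ⟨U.1 ∪ V.1, union_mem_admissible hY U.2 V.2⟩).1 = (g U).1 ∪ (g V).1) (x : X.space) :
    ∃ y, ∀ U : Y.space.Admissible, y ∈ U.1 ↔ x ∈ (g U).1 := by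
  by_cases hne : ∃ U, x ∉ (g U).1
  · have hprime : (filterAt g x).IsPrime :=
      ⟨fun U V hVU hU hV => hU (Order.PFilter.mem_of_le hVU hV), hne, fun U hU V hV =>
        ⟨⟨U.1 ∪ V.1, union_mem_admissible hY U.2 V.2⟩,
          fun h => ((hg U V).subset h).elim hU hV, Set.subset_union_left, Set.subset_union_right⟩⟩
    exact exists_forall_mem_iff_of_isPrime (OrderEmbedding.subtype _) (fun U => U.2.1) _ hprime
  · push Not at hne
    exact ⟨Y.space.m, fun U =>
      iff_of_true ((forall_mem_admissible_iff hY).2 rfl U.1 U.2) (hne U)⟩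

theorem exists_preimageHom_eq_iff_preservesJoins
    (g : InfTopHom Y.space.Admissible X.space.Admissible) :
    (∃ f : X ⟶ Y, preimageHom f = g) ↔
      DMS.PreservesJoins (DMS.ofHom g : admissibleDMS hY ⟶ admissibleDMS hX) := by
  rw [preservesJoins_iff_map_union]
  constructor
  · rintro ⟨f, rfl⟩ U V
    rfl
  · exact fun hg => exists_preimageHom_eq g (exists_forall_mem_iff_of_map_union hY hg)

include hX hY in
theorem preservesDensePart_iff {f : X ⟶ Y} :
    PreservesDensePart f ↔ ∀ x, f.map x = Y.space.m → x = X.space.m := by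
  have hX₀ : X.space.X₀ = {X.space.m}ᶜ := hX
  have hY₀ : Y.space.X₀ = {Y.space.m}ᶜ := hY
  simp only [PreservesDensePart, hX₀, hY₀, Set.mem_compl_singleton_iff, not_imp_not]

include hX hY in
theorem exists_preimageHom_le {f : X ⟶ Y} (hf : ∀ x, f.map x = Y.space.m → x = X.space.m)
    (V : X.space.Admissible) : ∃ U, preimageHom f U ≤ V := by
  obtain ⟨U, -, hUV⟩ := exists_subset_of_biInter_subset
    (φ := fun U : Y.space.Admissible => f.map ⁻¹' U.1) (fun _ _ h => Set.preimage_mono h)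
    (fun U => (f.preimage_mem U.1 U.2).1.1) ⟨⊤, Set.mem_univ _⟩
    (fun U _ V _ => ⟨U ⊓ V, Set.mem_univ _, inf_le_left, inf_le_right⟩) V.2.1.2 fun x hx => by
      have hfx : f.map x = Y.space.m := (forall_mem_admissible_iff hY).1 fun U hU =>
        Set.mem_iInter₂.1 hx ⟨U, hU⟩ (Set.mem_univ _)
      exact (forall_mem_admissible_iff hX).2 (hf x hfx) V.1 V.2
  exact ⟨U, hUV⟩

include hX hY in
theorem eq_m_of_map_eq_m {f : X ⟶ Y} (hf : ∀ V, ∃ U, preimageHom f U ≤ V) {x : X.space}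
    (hx : f.map x = Y.space.m) : x = X.space.m := by
  refine (forall_mem_admissible_iff hX).1 fun V hV => ?_
  obtain ⟨U, hUV⟩ := hf ⟨V, hV⟩
  exact hUV ((forall_mem_admissible_iff hY).2 hx U.1 U.2)

theorem liftsUpperBounds_preimageHom_iff {f : X ⟶ Y} :
    DMS.LiftsUpperBounds (DMS.ofHom (preimageHom f) : admissibleDMS hY ⟶ admissibleDMS hX) ↔
      PreservesDensePart f := by
  rw [DMS.liftsUpperBounds_iff (isLattice_admissibleDMS hY), preservesDensePart_iff hX hY,
    ← exists_preimageHom_eq_iff_preservesJoins]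
  exact ⟨fun h x => eq_m_of_map_eq_m hX hY h.2,
    fun h => ⟨⟨f, rfl⟩, exists_preimageHom_le hX hY h⟩⟩

end PGPSS

section PrimeFilters

variable (α : Type u) [Lattice α] [OrderTop α]

/-- The prime filters of a lattice, the improper one included, as characteristic functions. -/
def primeFilters : Set (α → Bool) :=
  {p | p ⊤ = true ∧ (∀ a b, p (a ⊓ b) = (p a && p b)) ∧ ∀ a b, p (a ⊔ b) = (p a || p b)}

theorem isClosed_primeFilters : IsClosed (primeFilters α) := by
  have hbinary (r : Set (Bool × Bool × Bool)) (a b c : α) :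
      IsClosed {p : α → Bool | (p a, p b, p c) ∈ r} :=
    (isClosed_discrete r).preimage (by fun_prop)
  simp only [primeFilters, Set.ofPred_and, Set.ofPred_forall]
  exact (isClosed_eq (continuous_apply ⊤) continuous_const).inter <|
    (isClosed_iInter fun a => isClosed_iInter fun b =>
      hbinary {t | t.1 = (t.2.1 && t.2.2)} (a ⊓ b) a b).inter <|
    isClosed_iInter fun a => isClosed_iInter fun b =>
      hbinary {t | t.1 = (t.2.1 || t.2.2)} (a ⊔ b) a b

instance : CompactSpace (primeFilters α) :=
  isCompact_iff_compactSpace.1 (isClosed_primeFilters α).isCompact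

instance : OrderTop (primeFilters α) where
  top := ⟨⊤, rfl, fun _ _ => rfl, fun _ _ => rfl⟩
  le_top p := show p.1 ≤ ⊤ from le_top

variable {α}

/-- The complement of a prime ideal, as a prime filter. -/
noncomputable def primeFilterOfIdeal (J : Order.Ideal α) (hJ : J.IsPrime) : primeFilters α := by
  classical
  refine ⟨fun x => decide (x ∉ J), ?_, fun a b => ?_, fun a b => ?_⟩
  · exact decide_eq_true fun htop => hJ.ne_top (Order.Ideal.top_of_top_mem htop)
  · have hinf : a ⊓ b ∈ J ↔ a ∈ J ∨ b ∈ J :=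
      ⟨hJ.mem_or_mem, fun h => h.elim (J.lower inf_le_left) (J.lower inf_le_right)⟩
    simp [hinf]
  · simp [Order.Ideal.sup_mem_iff, imp_iff_not_or]

/-- The prime filters containing `a`. -/
def primeFiltersContaining (a : α) : Set (primeFilters α) := {p | p.1 a = true}

theorem primeFilterOfIdeal_mem_iff {J : Order.Ideal α} {hJ : J.IsPrime} {a : α} :
    primeFilterOfIdeal J hJ ∈ primeFiltersContaining a ↔ a ∉ J := by
  simp [primeFilterOfIdeal, primeFiltersContaining]

theorem isClopen_primeFiltersContaining (a : α) : IsClopen (primeFiltersContaining a) :=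
  (isClopen_discrete {true}).preimage ((continuous_apply a).comp continuous_subtype_val)

theorem primeFilters_le_iff {p q : primeFilters α} :
    p ≤ q ↔ ∀ a, p ∈ primeFiltersContaining a → q ∈ primeFiltersContaining a :=
  forall_congr' fun _ => Bool.le_iff_imp

theorem isUpperSet_primeFiltersContaining (a : α) : IsUpperSet (primeFiltersContaining a) :=
  fun _ _ h hp => primeFilters_le_iff.1 h a hp

instance : PriestleySpace (primeFilters α) where
  priestley {p q} h := by
    rw [primeFilters_le_iff] at h
    push Not at h
    obtain ⟨a, hp, hq⟩ := h
    exact ⟨_, isClopen_primeFiltersContaining a, isUpperSet_primeFiltersContaining a, hp, hq⟩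

theorem primeFiltersContaining_inf (a b : α) : primeFiltersContaining (a ⊓ b) =
    primeFiltersContaining a ∩ primeFiltersContaining b :=
  Set.ext fun p => by simp [primeFiltersContaining, p.2.2.1 a b]

theorem primeFiltersContaining_sup (a b : α) : primeFiltersContaining (a ⊔ b) =
    primeFiltersContaining a ∪ primeFiltersContaining b :=
  Set.ext fun p => by simp [primeFiltersContaining, p.2.2.2 a b]

theorem monotone_primeFiltersContaining : Monotone (primeFiltersContaining (α := α)) := by
  intro a b hab
  rw [← sup_eq_right.2 hab, primeFiltersContaining_sup]
  exact Set.subset_union_left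

theorem exists_mem_primeFiltersContaining_subset {U : Set (primeFilters α)} (hU : IsOpen U)
    (hup : IsUpperSet U) {p : primeFilters α} (hp : p ∈ U) :
    ∃ a, p ∈ primeFiltersContaining a ∧ primeFiltersContaining a ⊆ U := by
  refine exists_subset_of_biInter_subset (D := {a | p ∈ primeFiltersContaining a})
    monotone_primeFiltersContaining (fun a => (isClopen_primeFiltersContaining a).1)
    ⟨⊤, p.2.1⟩ ?_ hU ?_
  · intro a ha b hb
    exact ⟨a ⊓ b, (primeFiltersContaining_inf a b).superset ⟨ha, hb⟩, inf_le_left, inf_le_right⟩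
  · intro q hq
    exact hup (primeFilters_le_iff.2 fun a ha => Set.mem_iInter₂.1 hq a ha) hp

theorem exists_primeFiltersContaining_eq {U : Set (primeFilters α)} (hU : IsClopen U)
    (hup : IsUpperSet U) (hne : U.Nonempty) : ∃ a, primeFiltersContaining a = U := by
  have hbasis := fun p (hp : p ∈ U) => exists_mem_primeFiltersContaining_subset hU.2 hup hp
  obtain ⟨a, ha, hUa⟩ := exists_subset_of_subset_biUnion
    (D := {a | primeFiltersContaining a ⊆ U}) monotone_primeFiltersContaining
    (fun a => (isClopen_primeFiltersContaining a).2)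
    (hne.elim fun p hp => (hbasis p hp).imp fun _ h => h.2)
    (fun a ha b hb => ⟨a ⊔ b, (primeFiltersContaining_sup a b).trans_subset
      (Set.union_subset ha hb), le_sup_left, le_sup_right⟩)
    hU.1.isCompact
    (fun p hp => by
      obtain ⟨a, hpa, ha⟩ := hbasis p hp
      exact Set.mem_biUnion ha hpa)
  exact ⟨a, Set.Subset.antisymm ha hUa⟩

theorem primeFiltersContaining_subset_iff {α : Type u} [DistribLattice α] [OrderTop α] {a b : α} :
    primeFiltersContaining a ⊆ primeFiltersContaining b ↔ a ≤ b := by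
  refine ⟨fun h => by_contra fun hab => ?_, fun h => monotone_primeFiltersContaining h⟩
  have hdisj : Disjoint (Order.PFilter.principal a : Set α) (Order.Ideal.principal b : Set α) :=
    Set.disjoint_left.2 fun x hx hx' => hab (le_trans hx hx')
  obtain ⟨J, hJ, hbJ, haJ⟩ := DistribLattice.prime_ideal_of_disjoint_filter_ideal hdisj
  have ha : a ∉ J := Set.disjoint_left.1 haJ (Order.PFilter.mem_principal.2 le_rfl)
  exact primeFilterOfIdeal_mem_iff.1 (h (primeFilterOfIdeal_mem_iff (hJ := hJ).2 ha))
    (Order.Ideal.principal_le_iff.1 hbJ)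

end PrimeFilters

namespace PGPS

/-- The pointed Priestley space of prime filters, with the improper filter as greatest element. -/
def primeFilterSpace (α : Type u) [Lattice α] [OrderTop α] : PGPS.{u} :=
  ofIsTop (primeFilters α) ⊤ isTop_top

theorem isPointedPriestley_primeFilterSpace (α : Type u) [Lattice α] [OrderTop α] :
    (primeFilterSpace α).IsPointedPriestley := rfl

/-- A distributive lattice is isomorphic to the admissible clopen upsets of its prime filters. -/
noncomputable def primeFiltersContainingIso (α : Type u) [DistribLattice α] [OrderTop α] :
    α ≃o (primeFilterSpace α).Admissible :=
  .ofSurjective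
    (OrderEmbedding.ofMapLEIff
      (fun a => ⟨primeFiltersContaining a,
        (mem_admissible_iff (isPointedPriestley_primeFilterSpace α)).2
          ⟨isClopen_primeFiltersContaining a, isUpperSet_primeFiltersContaining a, rfl⟩⟩)
      fun _ _ => primeFiltersContaining_subset_iff)
    fun U => by
      obtain ⟨hU, hup, hm⟩ :=
        (mem_admissible_iff (isPointedPriestley_primeFilterSpace α)).1 U.2
      obtain ⟨a, ha⟩ := exists_primeFiltersContaining_eq hU hup ⟨_, hm⟩
      exact ⟨a, Subtype.ext ha⟩

/-- Every distributive lattice with top is the lattice of admissible clopen upsets of the space of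
its prime filters. -/
noncomputable def admissibleDMSPrimeFilterSpaceIso {M : DMS.{u}} (hM : DMS.IsLattice M) :
    letI := M.distribLattice hM
    admissibleDMS (isPointedPriestley_primeFilterSpace M.obj) ≅ M :=
  letI := M.distribLattice hM
  DMS.isoOfOrderIso (primeFiltersContainingIso M.obj).symm

/-- The contravariant functor of admissible clopen upsets, on generalized Priestley morphisms. -/
def toDLM : PPS.{u}ᵒᵖ ⥤ DLM.{u} where
  obj X := ⟨admissibleDMS X.unop.property, isLattice_admissibleDMS X.unop.property⟩
  map f := ObjectProperty.homMk (DMS.ofHom (boxEquiv f.unop.hom))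
  map_id X := ObjectProperty.hom_ext _ (DMS.hom_ext fun U =>
    Subtype.ext (box_id X.unop.obj U.2))
  map_comp f g := ObjectProperty.hom_ext _ (DMS.hom_ext fun U =>
    Subtype.ext (Hom.box_comp g.unop.hom f.unop.hom U.2))

instance : toDLM.{u}.IsEquivalence where
  faithful := ⟨fun h => Quiver.Hom.unop_inj
    (ObjectProperty.hom_ext _ (boxEquiv.injective (congrArg (·.hom.hom) h)))⟩
  full := ⟨fun g => by
    obtain ⟨R, hR⟩ := boxEquiv.surjective (DMS.map g.hom)
    exact ⟨Quiver.Hom.op (ObjectProperty.homMk R),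
      ObjectProperty.hom_ext _ (congrArg DMS.ofHom hR)⟩⟩
  essSurj := ⟨fun M =>
    letI := M.obj.distribLattice M.property
    ⟨.op ⟨_, isPointedPriestley_primeFilterSpace M.obj.obj⟩,
      ⟨ObjectProperty.isoMk _ (admissibleDMSPrimeFilterSpaceIso M.property)⟩⟩⟩

end PGPS

namespace PGPSS

open PGPS

/-- The contravariant functor of admissible clopen upsets, on strong Priestley morphisms. -/
def toDLM : PPSS.{u}ᵒᵖ ⥤ DLM.{u} where
  obj X := ⟨admissibleDMS X.unop.property, isLattice_admissibleDMS X.unop.property⟩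
  map f := ObjectProperty.homMk (DMS.ofHom (preimageHom f.unop.hom))

instance : toDLM.{u}.Faithful where
  map_injective h := Quiver.Hom.unop_inj
    (ObjectProperty.hom_ext _ (preimageHom_injective (congrArg (·.hom.hom) h)))

instance : toDLM.{u}.EssSurj where
  mem_essImage M :=
    letI := M.obj.distribLattice M.property
    ⟨.op ⟨⟨_⟩, isPointedPriestley_primeFilterSpace M.obj.obj⟩,
      ⟨ObjectProperty.isoMk _ (admissibleDMSPrimeFilterSpaceIso M.property)⟩⟩

theorem exists_toDLM_map_eq_iff_preservesJoins {X Y : PPSS.{u}ᵒᵖ}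
    (g : toDLM.obj X ⟶ toDLM.obj Y) :
    (∃ f, toDLM.map f = g) ↔ DMS.PreservesJoins g.hom := by
  refine Iff.trans ?_ <| exists_preimageHom_eq_iff_preservesJoins Y.unop.property X.unop.property
    (DMS.map g.hom)
  constructor
  · rintro ⟨f, rfl⟩
    exact ⟨f.unop.hom, rfl⟩
  · rintro ⟨f, hf⟩
    exact ⟨Quiver.Hom.op (ObjectProperty.homMk f),
      ObjectProperty.hom_ext _ (congrArg DMS.ofHom hf)⟩

/-- The inclusion of the morphisms that preserve the dense part. -/
abbrev forgetDensePart : PPSP.{u}ᵒᵖ ⥤ PPSS.{u}ᵒᵖ :=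
  (forgetWide (fun X : PGPSS => X.space.IsPointedPriestley) PreservesDensePart).op

theorem exists_toDLM_map_eq_iff_liftsUpperBounds {X Y : PPSP.{u}ᵒᵖ}
    (g : (forgetDensePart ⋙ toDLM).obj X ⟶ (forgetDensePart ⋙ toDLM).obj Y) :
    (∃ f, (forgetDensePart ⋙ toDLM).map f = g) ↔ DMS.LiftsUpperBounds g.hom := by
  have hlifts {f : Y.unop.obj.obj ⟶ X.unop.obj.obj} :=
    liftsUpperBounds_preimageHom_iff Y.unop.property X.unop.property (f := f)
  constructor
  · rintro ⟨f, rfl⟩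
    exact hlifts.2 f.unop.hom.property
  · intro hg
    obtain ⟨f, rfl⟩ := (exists_toDLM_map_eq_iff_preservesJoins g).2
      (DMS.preservesJoins_of_liftsUpperBounds hg)
    exact ⟨Quiver.Hom.op (ObjectProperty.homMk ⟨f.unop.hom, hlifts.1 hg⟩), rfl⟩

/-- The functor `toDLM` with values in lattice homomorphisms. -/
def toDL : PPSS.{u}ᵒᵖ ⥤ DL.{u} :=
  corestrictWide toDLM fun f => (exists_toDLM_map_eq_iff_preservesJoins _).1 ⟨f, rfl⟩

instance : toDL.{u}.IsEquivalence :=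
  isEquivalence_corestrictWide _ exists_toDLM_map_eq_iff_preservesJoins
    DMS.isomorphisms_le_preservesJoins

/-- The functor `toDLM` on the strong Priestley morphisms that preserve the dense part. -/
def toDLP : PPSP.{u}ᵒᵖ ⥤ DLP.{u} :=
  corestrictWide (forgetDensePart ⋙ toDLM) fun f =>
    (exists_toDLM_map_eq_iff_liftsUpperBounds _).1 ⟨f, rfl⟩

instance : toDLP.{u}.IsEquivalence :=
  isEquivalence_corestrictWide _ exists_toDLM_map_eq_iff_liftsUpperBounds
    DMS.isomorphisms_le_liftsUpperBounds

end PGPSS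

end PointedPriestley

theorem mainTheorem11 :
    (Nonempty (PointedPriestley.ArFrmJ.{u} ≌ PointedPriestley.DLM.{u}) ∧
      Nonempty (PointedPriestley.ArFrmJ.{u}ᵒᵖ ≌ PointedPriestley.PPS.{u})) ∧
    (Nonempty (PointedPriestley.ArFrmS.{u} ≌ PointedPriestley.DL.{u}) ∧
      Nonempty (PointedPriestley.ArFrmS.{u}ᵒᵖ ≌ PointedPriestley.PPSS.{u})) ∧
    (Nonempty (PointedPriestley.ArFrm.{u} ≌ PointedPriestley.DLP.{u}) ∧
      Nonempty (PointedPriestley.ArFrm.{u}ᵒᵖ ≌ PointedPriestley.PPSP.{u})) := by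
  let eJ := PointedPriestley.AlgFrmJ.toDLM.{u}.asEquivalence
  let eS := PointedPriestley.AlgFrmJ.toDL.{u}.asEquivalence
  let eP := PointedPriestley.AlgFrmJ.toDLP.{u}.asEquivalence
  let dJ := PointedPriestley.PGPS.toDLM.{u}.asEquivalence
  let dS := PointedPriestley.PGPSS.toDL.{u}.asEquivalence
  let dP := PointedPriestley.PGPSS.toDLP.{u}.asEquivalence
  exact ⟨⟨⟨eJ⟩, ⟨PointedPriestley.dualEquivalence eJ dJ⟩⟩,
    ⟨⟨eS⟩, ⟨PointedPriestley.dualEquivalence eS dS⟩⟩,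
    ⟨⟨eP⟩, ⟨PointedPriestley.dualEquivalence eP dP⟩⟩⟩
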